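/- For a class $\mathcal F$ of functions $X\to\mathbb R$ and $\epsilon>0$, define three dimensions in $\{0,1,2,\dots,\infty\}$ (all equal to $0$ for the empty class). * $\mathrm{fat}(\mathcal F,\epsilon)$ is the largest $d$ such that there are distinct $x_1,\dots,x_d\in X$ and $\theta_1,\dots,\theta_d\in\mathbb R$ such that for every $b\in\{0,1\}^d$ some $f\in\mathcal F$ satisfies $f(x_j)\ge\theta_j+\epsilon$ whenever $b_j=1$ and $f(x_j)\le\theta_j$ whenever $b_j=0$. * $\mathrm{sfat}(\mathcal F,\epsilon)$ is the largest depth $d$ of a complete binary tree whose internal nodes $v$ are labelled by points $x(v)\in X$ and witnesses $\theta(v)\in\mathbb R$ and whose leaves $\ell$ are labelled by $f_\ell\in\mathcal F$, such that for every root-to-leaf path $v_1,\dots,v_d,v_{d+1}=\ell$ and every $i\le d$: $f_\ell(x(v_i))\ge\theta(v_i)+\epsilon$ if $v_{i+1}$ is the left child of $v_i$, and $f_\ell(x(v_i))\le\theta(v_i)$ if it is the right child. * $\mathrm{fatr}(\mathcal F,\epsilon)$ is the largest $d$ such that there are distinct $f_1,\dots,f_d\in\mathcal F$, distinct $x_1,\dots,x_d\in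 X$ and $\theta\in\mathbb R$ with $f_i(x_j)\ge\theta+\epsilon$ for $i\le j$ and $f_i(x_j)\le\theta$ for $i>j$. Let $G$ be a $k$-player game with action sets $\mathcal A_1,\dots,\mathcal A_k$ (arbitrary sets), profiles $\mathcal A=\prod_p\mathcal A_p$ and utilities $u_p:\mathcal A\to[0,1]$. Let $\mathcal F_p=\{x\mapsto u_p(x,a_{-p}) : a_{-p}\in\prod_{q\ne p}\mathcal A_q\}$, a class over $\mathcal A_p$, and put $\mathrm{fat}(G,\epsilon)=\max_p\mathrm{fat}(\mathcal F_p,\epsilon)$, and likewise $\mathrm{sfat}(G,\epsilon)$ and $\mathrm{fatr}(G,\epsilon)$. The CCE matrix of $G$ is $$M[a,(p,d_p)]=u_p(d_p,a_{-p})-u_p(a_p,a_{-p}),\qquad a\in\mathcal A,\ p\in\{1,\dots,k\},\ d_p\in\mathcal A_p,$$ viewed as the class of its rows $M[a,\cdot]$ over the disjoint union of the sets $\mathcal A_p$. There is a universal constant $C>0$ such that for every $k$, every such game $G$ and every $\epsilon>0$: 1. if $\mathrm{fat}(G,\epsilon)<\infty$ and $D=\max(\mathrm{fat}(G,\epsilon),2)$,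 then $\mathrm{fat}(M,16\epsilon)\le C\,k\,D\,\log D\,\log^2(1/\epsilon)$; 2. $\mathrm{sfat}(M,2\epsilon)\le C\,\dfrac{k}{\epsilon}\,\max(\mathrm{sfat}(G,\epsilon),1)$; 3. if $\epsilon\le 1$, then $\mathrm{fatr}(M,2\epsilon)\le\dfrac{k}{\epsilon}\,\mathrm{fatr}(G,\epsilon)$. -/

import Mathlib

universe v

/-! Combinatorial dimensions of real-valued function classes. A function class over a domain `X`
is a set of functions `X → ℝ`; dimensions take values in `ℕ∞`, and the dimension of the empty
class is `0`. -/

/-- `F` shatters some `d`-element subset `{x₁, …, x_d}` of `X` with margin `ε`, with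
witnesses `θ₁, …, θ_d`. -/
def FatShatters {X : Type*} (F : Set (X → ℝ)) (ε : ℝ) (d : ℕ) : Prop :=
  ∃ (x : Fin d → X) (θ : Fin d → ℝ), Function.Injective x ∧
    ∀ b : Fin d → Bool, ∃ f ∈ F, ∀ j : Fin d,
      (b j = true → θ j + ε ≤ f (x j)) ∧ (b j = false → f (x j) ≤ θ j)

/-- The `ε`-fat-shattering dimension. -/
noncomputable def fatDim {X : Type*} (F : Set (X → ℝ)) (ε : ℝ) : ℕ∞ :=
  ⨆ (d : ℕ) (_ : FatShatters F ε d), (d : ℕ∞)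

/-- A labelled complete binary tree of depth `d`. A node at depth `i` is the sequence of the `i`
turns that lead to it from the root (`true` is left, `false` is right). Internal nodes (depth
`< d`) carry a point of `X` and a witness, leaves (depth `d`) carry a function. -/
structure LabelledTree (X : Type*) (d : ℕ) where
  point : (i : Fin d) → (Fin i → Bool) → X
  witness : (i : Fin d) → (Fin i → Bool) → ℝ
  leaf : (Fin d → Bool) → X → ℝ

/-- The internal node at depth `i` on the root-to-leaf path that ends in the leaf `b`. -/
def nodeOnPath {d : ℕ} (b : Fin d → Bool) (i : Fin d) : Fin i → Bool :=
  fun j => b ⟨j, j.isLt.trans i.isLt⟩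

/-- The leaves of the tree are in `F`, and along every root-to-leaf path the function at the leaf
is at least the witness plus `ε` where the path turns left, and at most the witness where it
turns right. -/
def LabelledTree.IsShattered {X : Type*} {d : ℕ} (T : LabelledTree X d) (F : Set (X → ℝ))
    (ε : ℝ) : Prop :=
  (∀ b : Fin d → Bool, T.leaf b ∈ F) ∧
  ∀ (b : Fin d → Bool) (i : Fin d),
    (b i = true →
      T.witness i (nodeOnPath b i) + ε ≤ T.leaf b (T.point i (nodeOnPath b i))) ∧
    (b i = false →
      T.leaf b (T.point i (nodeOnPath b i)) ≤ T.witness i (nodeOnPath b i))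

/-- The `ε`-sequential-fat-shattering dimension. -/
noncomputable def sfatDim {X : Type*} (F : Set (X → ℝ)) (ε : ℝ) : ℕ∞ :=
  ⨆ (d : ℕ) (_ : ∃ T : LabelledTree X d, T.IsShattered F ε), (d : ℕ∞)

/-- `F` contains an `ε`-fat threshold pattern of size `d`, with one common witness `θ`. -/
def FatThresholds {X : Type*} (F : Set (X → ℝ)) (ε : ℝ) (d : ℕ) : Prop :=
  ∃ (f : Fin d → X → ℝ) (x : Fin d → X) (θ : ℝ),
    Function.Injective f ∧ Function.Injective x ∧ (∀ i, f i ∈ F) ∧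
    ∀ i j : Fin d, (i ≤ j → θ + ε ≤ f i (x j)) ∧ (j < i → f i (x j) ≤ θ)

/-- The `ε`-fat-threshold dimension. -/
noncomputable def fatrDim {X : Type*} (F : Set (X → ℝ)) (ε : ℝ) : ℕ∞ :=
  ⨆ (d : ℕ) (_ : FatThresholds F ε d), (d : ℕ∞)

/-- A `k`-player game: a set of actions and a utility function for each player. -/
structure Game (k : ℕ) where
  Action : Fin k → Type v
  utility : Fin k → ((p : Fin k) → Action p) → ℝ

namespace Game

/-- Action profiles. -/
abbrev Profile {k : ℕ} (G : Game k) := (p : Fin k) → G.Action p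

/-- Actions of all the players but `p`. -/
abbrev Others {k : ℕ} (G : Game k) (p : Fin k) := (q : {q : Fin k // q ≠ p}) → G.Action q

/-- `a₋ₚ`, the actions in `a` of all the players but `p`. -/
def others {k : ℕ} (G : Game k) (p : Fin k) (a : G.Profile) : G.Others p := fun q => a q

/-- The profile `(x, b)` in which `p` plays `x` and the other players play `b`. -/
def combine {k : ℕ} (G : Game k) (p : Fin k) (x : G.Action p) (b : G.Others p) : G.Profile :=
  (Equiv.piSplitAt p G.Action).symm (x, b)

/-- The utility class of player `p`: the functions `x ↦ uₚ(x, b)` on the actions of `p`, one for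
each choice `b` of actions of the other players. -/
def utilityClass {k : ℕ} (G : Game k) (p : Fin k) : Set (G.Action p → ℝ) :=
  Set.range fun (b : G.Others p) (x : G.Action p) => G.utility p (G.combine p x b)

/-- The dimension of a game is the maximum of the dimensions of its utility classes. -/
noncomputable def fat {k : ℕ} (G : Game k) (ε : ℝ) : ℕ∞ := ⨆ p, fatDim (G.utilityClass p) ε

noncomputable def sfat {k : ℕ} (G : Game k) (ε : ℝ) : ℕ∞ := ⨆ p, sfatDim (G.utilityClass p) ε

noncomputable def fatr {k : ℕ} (G : Game k) (ε : ℝ) : ℕ∞ := ⨆ p, fatrDim (G.utilityClass p) ε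

/-- The CCE matrix: its entry at `(a, (p, x))` is the gain of `p` from deviating to `x` at the
profile `a`. -/
def cceMatrix {k : ℕ} (G : Game k) (a : G.Profile) (y : Σ p, G.Action p) : ℝ :=
  G.utility y.1 (G.combine y.1 y.2 (G.others y.1 a)) - G.utility y.1 a

/-- The rows of the CCE matrix as a function class over the disjoint union of the action sets. -/
def cceClass {k : ℕ} (G : Game k) : Set ((Σ p, G.Action p) → ℝ) := Set.range G.cceMatrix

end Game

/-! On the columns of player `p`, the row of the CCE matrix at the profile `a` is the utility
function `uₚ(·, a₋ₚ)` minus the constant `uₚ(a) ∈ [0, 1]`. All three dimensions are subadditive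
over a disjoint union of domains, which costs the factor `k` and leaves the class of the translates
of one utility class `F` by constants in `[0, 1]`. Cut `[0, 1]` into about `1 / ε` windows of
length `ε`: for the translates by the constants of one window, moving the witnesses to the top of
the window turns a pattern of margin `2ε` into a pattern of `F` of margin `ε`. A union of `N`
classes multiplies the sequential and the threshold dimensions by about `N`, but by Sauer–Shelah it
adds only `log N` to the fat-shattering dimension (up to constants). -/

theorem FatShatters.le_fatDim {X : Type*} {F : Set (X → ℝ)} {ε : ℝ} {d : ℕ}
    (h : FatShatters F ε d) : (d : ℕ∞) ≤ fatDim F ε :=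
  le_iSup₂ (f := fun (d : ℕ) (_ : FatShatters F ε d) => (d : ℕ∞)) d h

theorem FatThresholds.le_fatrDim {X : Type*} {F : Set (X → ℝ)} {ε : ℝ} {d : ℕ}
    (h : FatThresholds F ε d) : (d : ℕ∞) ≤ fatrDim F ε :=
  le_iSup₂ (f := fun (d : ℕ) (_ : FatThresholds F ε d) => (d : ℕ∞)) d h

theorem LabelledTree.IsShattered.le_sfatDim {X : Type*} {F : Set (X → ℝ)} {ε : ℝ} {d : ℕ}
    {T : LabelledTree X d} (h : T.IsShattered F ε) : (d : ℕ∞) ≤ sfatDim F ε :=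
  le_iSup₂ (f := fun (d : ℕ) (_ : ∃ T : LabelledTree X d, T.IsShattered F ε) => (d : ℕ∞)) d ⟨T, h⟩

section Indexing

variable {X J : Type*} [Fintype J] {F : Set (X → ℝ)} {ε : ℝ}

theorem FatShatters.of_fintype {x : J → X} (hx : Function.Injective x) (θ : J → ℝ)
    (h : ∀ b : J → Bool, ∃ f ∈ F, ∀ j,
      (b j = true → θ j + ε ≤ f (x j)) ∧ (b j = false → f (x j) ≤ θ j)) :
    FatShatters F ε (Fintype.card J) := by
  let e := Fintype.equivFin J
  refine ⟨x ∘ e.symm, θ ∘ e.symm, hx.comp e.symm.injective, fun b => ?_⟩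
  obtain ⟨f, hf, hfb⟩ := h (b ∘ e)
  exact ⟨f, hf, fun j => by simpa using hfb (e.symm j)⟩

theorem FatThresholds.of_linearOrder [LinearOrder J] (hε : 0 < ε) {f : J → X → ℝ}
    (hf : ∀ i, f i ∈ F) {x : J → X} {θ : ℝ}
    (h : ∀ i j, (i ≤ j → θ + ε ≤ f i (x j)) ∧ (j < i → f i (x j) ≤ θ)) :
    FatThresholds F ε (Fintype.card J) := by
  have hf_inj : Function.Injective f := .of_lt_imp_ne fun i j hij heq => by
    linarith [(h i i).1 le_rfl, (h j i).2 hij, congrFun heq (x i)]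
  have hx_inj : Function.Injective x := .of_lt_imp_ne fun i j hij heq => by
    linarith [(h j j).1 le_rfl, (h j i).2 hij, congrArg (f j) heq]
  let e := Fintype.orderIsoFinOfCardEq J rfl
  exact ⟨f ∘ e, x ∘ e, θ, hf_inj.comp e.injective, hx_inj.comp e.injective, fun i => hf (e i),
    fun i j => ⟨fun hij => (h _ _).1 (e.monotone hij), fun hij => (h _ _).2 (e.strictMono hij)⟩⟩

theorem card_eq_sum_card_fiber {P : Type*} [Fintype P] [DecidableEq P] (c : J → P) :
    Fintype.card J = ∑ p, Fintype.card {j // c j = p} := by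
  rw [← Fintype.card_sigma, Fintype.card_congr (Equiv.sigmaFiberEquiv c)]

end Indexing

/-- A reduction of `H` at margin `δ` to `F` at margin `ε`: moving all witnesses by the same amount
`t` turns every pattern that `H` realizes with margin `δ` into a pattern that `F` realizes with
margin `ε`. -/
def MarginReduces {X : Type*} (H : Set (X → ℝ)) (δ : ℝ) (F : Set (X → ℝ)) (ε : ℝ) : Prop :=
  ∃ t : ℝ, ∀ h ∈ H, ∃ f ∈ F, ∀ x θ,
    (θ + δ ≤ h x → θ + t + ε ≤ f x) ∧ (h x ≤ θ → f x ≤ θ + t)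

section MarginReduces

variable {X : Type*} {F H : Set (X → ℝ)} {δ ε : ℝ}

theorem MarginReduces.of_subset_of_le (hHF : H ⊆ F) (hεδ : ε ≤ δ) : MarginReduces H δ F ε :=
  ⟨0, fun h hh => ⟨h, hHF hh, fun _ _ => ⟨fun _ => by linarith, fun _ => by linarith⟩⟩⟩

theorem MarginReduces.fatDim_le (hHF : MarginReduces H δ F ε) : fatDim H δ ≤ fatDim F ε := by
  obtain ⟨t, ht⟩ := hHF
  refine iSup₂_le fun d ⟨x, θ, hx, h⟩ => ?_
  refine FatShatters.le_fatDim ⟨x, fun j => θ j + t, hx, fun b => ?_⟩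
  obtain ⟨g, hg, hgb⟩ := h b
  obtain ⟨f, hf, hfg⟩ := ht g hg
  exact ⟨f, hf, fun j => ⟨(hfg _ _).1 ∘ (hgb j).1, (hfg _ _).2 ∘ (hgb j).2⟩⟩

theorem MarginReduces.sfatDim_le (hHF : MarginReduces H δ F ε) : sfatDim H δ ≤ sfatDim F ε := by
  obtain ⟨t, ht⟩ := hHF
  refine iSup₂_le fun d ⟨T, hT_mem, hT⟩ => ?_
  choose f hf hfT using fun b => ht _ (hT_mem b)
  let T' : LabelledTree X d := ⟨T.point, fun i b => T.witness i b + t, f⟩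
  have hT' : T'.IsShattered F ε :=
    ⟨hf, fun b i => ⟨(hfT b _ _).1 ∘ (hT b i).1, (hfT b _ _).2 ∘ (hT b i).2⟩⟩
  exact hT'.le_sfatDim

theorem MarginReduces.fatrDim_le (hε : 0 < ε) (hHF : MarginReduces H δ F ε) :
    fatrDim H δ ≤ fatrDim F ε := by
  obtain ⟨t, ht⟩ := hHF
  refine iSup₂_le fun d ⟨h, x, θ, _, _, hh, hθ⟩ => ?_
  choose f hf hfh using fun i => ht _ (hh i)
  have hd := FatThresholds.of_linearOrder hε hf (x := x) (θ := θ + t) fun i j =>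
    ⟨(hfh i _ _).1 ∘ (hθ i j).1, (hfh i _ _).2 ∘ (hθ i j).2⟩
  simpa using hd.le_fatrDim

end MarginReduces

section SeqShatters

variable {X : Type*} {F H : Set (X → ℝ)} {ε : ℝ} {d : ℕ}

/-- `F` shatters some tree of depth `d` with margin `ε`; the sequential counterpart of
`FatShatters`. -/
def SeqShatters (F : Set (X → ℝ)) (ε : ℝ) (d : ℕ) : Prop :=
  ∃ T : LabelledTree X d, T.IsShattered F ε

theorem SeqShatters.le_sfatDim (h : SeqShatters F ε d) : (d : ℕ∞) ≤ sfatDim F ε :=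
  h.choose_spec.le_sfatDim

theorem SeqShatters.mono (hFH : F ⊆ H) (h : SeqShatters F ε d) : SeqShatters H ε d :=
  h.imp fun _ hT => ⟨fun b => hFH (hT.1 b), hT.2⟩

theorem SeqShatters.nonempty (h : SeqShatters F ε d) : F.Nonempty :=
  let ⟨_, hT⟩ := h
  ⟨_, hT.1 fun _ => true⟩

theorem seqShatters_zero_iff : SeqShatters F ε 0 ↔ F.Nonempty :=
  ⟨SeqShatters.nonempty, fun ⟨f, hf⟩ =>
    ⟨⟨fun i => i.elim0, fun i => i.elim0, fun _ => f⟩, fun _ => hf, fun _ i => i.elim0⟩⟩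

/-- The subtree hanging from the child `c` of the root. -/
def LabelledTree.child (T : LabelledTree X (d + 1)) (c : Bool) : LabelledTree X d where
  point i b := T.point i.succ (Fin.cons c b : Fin (i + 1) → Bool)
  witness i b := T.witness i.succ (Fin.cons c b : Fin (i + 1) → Bool)
  leaf b := T.leaf (Fin.cons c b : Fin (d + 1) → Bool)

/-- The tree whose root is labelled by `x` and `θ` and whose left and right subtrees are `L` and
`R`. -/
def LabelledTree.node (x : X) (θ : ℝ) (L R : LabelledTree X d) : LabelledTree X (d + 1) where
  point := Fin.cases (fun _ => x) fun i (b : Fin (i + 1) → Bool) =>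
    (bif b 0 then L else R).point i (Fin.tail b)
  witness := Fin.cases (fun _ => θ) fun i (b : Fin (i + 1) → Bool) =>
    (bif b 0 then L else R).witness i (Fin.tail b)
  leaf b := (bif b 0 then L else R).leaf (Fin.tail b)

theorem nodeOnPath_zero (b : Fin (d + 1) → Bool) : nodeOnPath b 0 = Fin.elim0 :=
  funext fun j => j.elim0

theorem nodeOnPath_cons_succ (c : Bool) (b : Fin d → Bool) (i : Fin d) :
    nodeOnPath (Fin.cons c b : Fin (d + 1) → Bool) i.succ =
      (Fin.cons c (nodeOnPath b i) : Fin (i + 1) → Bool) := by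
  funext j
  refine Fin.cases ?_ (fun j => ?_) j <;> rfl

theorem LabelledTree.IsShattered.child {T : LabelledTree X (d + 1)} (hT : T.IsShattered F ε)
    {c : Bool} (hH : ∀ b, T.leaf (Fin.cons c b : Fin (d + 1) → Bool) ∈ H) :
    (T.child c).IsShattered H ε := by
  refine ⟨hH, fun b i => ?_⟩
  have hTi := hT.2 (Fin.cons c b) i.succ
  rwa [nodeOnPath_cons_succ, Fin.cons_succ] at hTi

theorem LabelledTree.IsShattered.node {x : X} {θ : ℝ} {L R : LabelledTree X d}
    (hL : L.IsShattered {f ∈ F | θ + ε ≤ f x} ε) (hR : R.IsShattered {f ∈ F | f x ≤ θ} ε) :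
    (LabelledTree.node x θ L R).IsShattered F ε := by
  refine ⟨fun b => ?_, fun b i => ?_⟩ <;> rw [← Fin.cons_self_tail b]
  · cases b 0
    exacts [(hR.1 (Fin.tail b)).1, (hL.1 (Fin.tail b)).1]
  · cases i using Fin.cases with
    | zero =>
      cases b 0
      · exact ⟨nofun, fun _ => (hR.1 (Fin.tail b)).2⟩
      · exact ⟨fun _ => (hL.1 (Fin.tail b)).2, nofun⟩
    | succ i =>
      rw [nodeOnPath_cons_succ, Fin.cons_succ]
      cases b 0
      exacts [hR.2 (Fin.tail b) i, hL.2 (Fin.tail b) i]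

theorem seqShatters_succ_iff :
    SeqShatters F ε (d + 1) ↔ ∃ x θ, SeqShatters {f ∈ F | θ + ε ≤ f x} ε d ∧
      SeqShatters {f ∈ F | f x ≤ θ} ε d := by
  refine ⟨fun ⟨T, hT⟩ => ?_, fun ⟨x, θ, ⟨L, hL⟩, ⟨R, hR⟩⟩ => ⟨_, hL.node hR⟩⟩
  have hroot := fun b => nodeOnPath_zero b ▸ hT.2 b 0
  exact ⟨T.point 0 Fin.elim0, T.witness 0 Fin.elim0,
    ⟨_, hT.child fun b => ⟨hT.1 _, (hroot (Fin.cons true b)).1 rfl⟩⟩,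
    ⟨_, hT.child fun b => ⟨hT.1 _, (hroot (Fin.cons false b)).2 rfl⟩⟩⟩

theorem seqShatters_antitone (F : Set (X → ℝ)) (ε : ℝ) : Antitone (SeqShatters F ε) :=
  antitone_nat_of_succ_le fun _ h =>
    let ⟨_, _, hL, _⟩ := seqShatters_succ_iff.1 h
    hL.mono fun _ hf => hf.1

theorem natCast_le_sfatDim_iff (hF : F.Nonempty) : (d : ℕ∞) ≤ sfatDim F ε ↔ SeqShatters F ε d := by
  refine ⟨fun hd => ?_, SeqShatters.le_sfatDim⟩
  cases d with
  | zero => exact seqShatters_zero_iff.2 hF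
  | succ d =>
    obtain ⟨n, hn⟩ := lt_iSup_iff.1 (ENat.natCast_add_one_le_iff.1 hd)
    obtain ⟨hF_n, hdn⟩ := lt_iSup_iff.1 hn
    exact seqShatters_antitone F ε (Nat.succ_le_of_lt (by exact_mod_cast hdn)) hF_n

theorem min_sfatDim_add_one_le {x : X} {θ : ℝ} (hL : {f ∈ F | θ + ε ≤ f x}.Nonempty)
    (hR : {f ∈ F | f x ≤ θ}.Nonempty) :
    min (sfatDim {f ∈ F | θ + ε ≤ f x} ε) (sfatDim {f ∈ F | f x ≤ θ} ε) + 1 ≤ sfatDim F ε := by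
  refine ENat.forall_natCast_le_iff_le.1 fun n hn => ?_
  cases n with
  | zero => exact zero_le
  | succ n =>
    have hn_min : (n : ℕ∞) ≤ min _ _ := (ENat.add_le_add_iff_right ENat.one_ne_top).1 hn
    have ⟨hnL, hnR⟩ := le_min_iff.1 hn_min
    exact (seqShatters_succ_iff.2 ⟨x, θ, (natCast_le_sfatDim_iff hL).1 hnL,
      (natCast_le_sfatDim_iff hR).1 hnR⟩).le_sfatDim

theorem SeqShatters.or_of_union {A B : Set (X → ℝ)} {a b : ℕ}
    (h : SeqShatters (A ∪ B) ε (a + b)) : SeqShatters A ε a ∨ SeqShatters B ε b := by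
  induction a generalizing A B with
  | zero =>
    rcases A.eq_empty_or_nonempty with rfl | hA
    · rw [Set.empty_union, Nat.zero_add] at h
      exact .inr h
    · exact .inl (seqShatters_zero_iff.2 hA)
  | succ a ih =>
    rw [Nat.add_right_comm, seqShatters_succ_iff] at h
    obtain ⟨x, θ, hL, hR⟩ := h
    simp only [Set.mem_union, Set.sep_union] at hL hR
    rcases ih hL with hAL | hBL
    · rcases ih hR with hAR | hBR
      · exact .inl (seqShatters_succ_iff.2 ⟨x, θ, hAL, hAR⟩)
      · exact .inr (hBR.mono fun _ hf => hf.1)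
    · exact .inr (hBL.mono fun _ hf => hf.1)

theorem sfatDim_union_le (A B : Set (X → ℝ)) :
    sfatDim (A ∪ B) ε ≤ sfatDim A ε + sfatDim B ε + 1 := by
  by_contra! h
  obtain ⟨⟨a, ha⟩, ⟨b, hb⟩⟩ : (∃ a : ℕ, a = sfatDim A ε) ∧ ∃ b : ℕ, b = sfatDim B ε := by
    simp only [← ENat.ne_top_iff_exists]
    constructor <;> intro htop <;> simp [htop] at h
  rw [← ha, ← hb] at h
  obtain ⟨n, hn⟩ := lt_iSup_iff.1 h
  obtain ⟨hAB, hlt⟩ := lt_iSup_iff.1 hn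
  have hle : (a + 1) + (b + 1) ≤ n := by
    have : a + b + 1 < n := by exact_mod_cast hlt
    lia
  rcases (seqShatters_antitone _ ε hle hAB).or_of_union with hA | hB
  · have := ha ▸ hA.le_sfatDim
    norm_cast at this
    lia
  · have := hb ▸ hB.le_sfatDim
    norm_cast at this
    lia

theorem sfatDim_biUnion_le {J : Type*} (s : Finset J) (H : J → Set (X → ℝ)) :
    sfatDim (⋃ j ∈ s, H j) ε ≤ ∑ j ∈ s, (sfatDim (H j) ε + 1) := by
  classical
  induction s using Finset.induction_on with
  | empty => exact iSup₂_le fun d hd => by simpa using SeqShatters.nonempty hd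
  | insert j s hj ih =>
    rw [Finset.set_biUnion_insert, Finset.sum_insert hj, add_right_comm]
    exact (sfatDim_union_le _ _).trans (by gcongr)

end SeqShatters

section DisjointUnion

variable {P : Type*} {X : P → Type*} {ε : ℝ}

/-- The restriction of a class over a disjoint union `Σ p, X p` to its `p`-th summand. -/
def sigmaBlock (H : Set ((Σ p, X p) → ℝ)) (p : P) : Set (X p → ℝ) :=
  (fun f x => f ⟨p, x⟩) '' H

theorem sigmaBlock_sep (H : Set ((Σ p, X p) → ℝ)) (p : P) (Q : (X p → ℝ) → Prop) :
    sigmaBlock {f ∈ H | Q fun x => f ⟨p, x⟩} p = {g ∈ sigmaBlock H p | Q g} := by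
  ext g
  constructor
  · rintro ⟨f, ⟨hf, hQ⟩, rfl⟩
    exact ⟨⟨f, hf, rfl⟩, hQ⟩
  · rintro ⟨⟨f, hf, rfl⟩, hQ⟩
    exact ⟨f, ⟨hf, hQ⟩, rfl⟩

theorem exists_eq_sigmaMk {p : P} {x : Σ p, X p} (hx : x.1 = p) : ∃ y : X p, x = ⟨p, y⟩ := by
  subst hx
  exact ⟨x.2, rfl⟩

theorem min_sfatDim_sigmaBlock_add_one_le {H : Set ((Σ p, X p) → ℝ)} {p : P} {x : X p} {θ : ℝ}
    (hL : {f ∈ H | θ + ε ≤ f ⟨p, x⟩}.Nonempty) (hR : {f ∈ H | f ⟨p, x⟩ ≤ θ}.Nonempty) :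
    min (sfatDim (sigmaBlock {f ∈ H | θ + ε ≤ f ⟨p, x⟩} p) ε)
      (sfatDim (sigmaBlock {f ∈ H | f ⟨p, x⟩ ≤ θ} p) ε) + 1 ≤ sfatDim (sigmaBlock H p) ε := by
  have hL_block : (sigmaBlock {f ∈ H | θ + ε ≤ f ⟨p, x⟩} p).Nonempty := hL.image _
  have hR_block : (sigmaBlock {f ∈ H | f ⟨p, x⟩ ≤ θ} p).Nonempty := hR.image _
  rw [sigmaBlock_sep H p fun g => _ ≤ g x] at hL_block ⊢
  rw [sigmaBlock_sep H p fun g => g x ≤ _] at hR_block ⊢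
  exact min_sfatDim_add_one_le hL_block hR_block

variable [Fintype P]

theorem fatDim_le_sum_sigmaBlock (H : Set ((Σ p, X p) → ℝ)) :
    fatDim H ε ≤ ∑ p, fatDim (sigmaBlock H p) ε := by
  classical
  refine iSup₂_le fun d ⟨x, θ, hx, h⟩ => ?_
  have hblock (p : P) : FatShatters (sigmaBlock H p) ε (Fintype.card {j // (x j).1 = p}) := by
    choose y hy using fun j : {j // (x j).1 = p} => exists_eq_sigmaMk j.2
    have hy_inj : Function.Injective y := fun i j hij =>
      Subtype.ext (hx (by rw [hy, hy, hij]))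
    refine FatShatters.of_fintype hy_inj (fun j => θ j) fun b => ?_
    obtain ⟨f, hf, hfb⟩ := h fun j => if hj : (x j).1 = p then b ⟨j, hj⟩ else false
    exact ⟨_, ⟨f, hf, rfl⟩, fun j => by simpa only [← hy, dif_pos j.2] using hfb j⟩
  calc (d : ℕ∞) = ∑ p, (Fintype.card {j // (x j).1 = p} : ℕ∞) := by
        exact_mod_cast (Fintype.card_fin d).symm.trans (card_eq_sum_card_fiber fun j => (x j).1)
    _ ≤ ∑ p, fatDim (sigmaBlock H p) ε := Finset.sum_le_sum fun p _ => (hblock p).le_fatDim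

theorem fatrDim_le_sum_sigmaBlock (hε : 0 < ε) (H : Set ((Σ p, X p) → ℝ)) :
    fatrDim H ε ≤ ∑ p, fatrDim (sigmaBlock H p) ε := by
  classical
  refine iSup₂_le fun d ⟨f, x, θ, _, _, hf, h⟩ => ?_
  have hblock (p : P) : FatThresholds (sigmaBlock H p) ε (Fintype.card {j // (x j).1 = p}) := by
    choose y hy using fun j : {j // (x j).1 = p} => exists_eq_sigmaMk j.2
    exact FatThresholds.of_linearOrder hε (fun j => ⟨f j, hf j, rfl⟩) (x := y) (θ := θ)
      fun i j => by simpa only [← hy, Subtype.coe_le_coe, Subtype.coe_lt_coe] using h i j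
  calc (d : ℕ∞) = ∑ p, (Fintype.card {j // (x j).1 = p} : ℕ∞) := by
        exact_mod_cast (Fintype.card_fin d).symm.trans (card_eq_sum_card_fiber fun j => (x j).1)
    _ ≤ ∑ p, fatrDim (sigmaBlock H p) ε := Finset.sum_le_sum fun p _ => (hblock p).le_fatrDim

theorem sum_add_le_sum_of_le_of_add_le {M : Type*} [AddCommMonoid M] [PartialOrder M]
    [IsOrderedAddMonoid M] {f g : P → M} {c : M} (hfg : f ≤ g) {p : P} (hp : f p + c ≤ g p) :
    ∑ q, f q + c ≤ ∑ q, g q := by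
  classical
  calc ∑ q, f q + c = f p + c + ∑ q ∈ Finset.univ.erase p, f q := by
        rw [← Finset.add_sum_erase _ f (Finset.mem_univ p), add_right_comm]
    _ ≤ g p + ∑ q ∈ Finset.univ.erase p, g q := by gcongr with q; exact hfg q
    _ = ∑ q, g q := Finset.add_sum_erase _ g (Finset.mem_univ p)

theorem SeqShatters.le_sum_sigmaBlock {n : ℕ} {H : Set ((Σ p, X p) → ℝ)}
    (h : SeqShatters H ε n) : (n : ℕ∞) ≤ ∑ p, sfatDim (sigmaBlock H p) ε := by
  induction n generalizing H with
  | zero => exact zero_le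
  | succ n ih =>
    obtain ⟨⟨p, x⟩, θ, hL, hR⟩ := seqShatters_succ_iff.1 h
    have hsub {Q : ((Σ p, X p) → ℝ) → Prop} (q : P) :
        sfatDim (sigmaBlock {f ∈ H | Q f} q) ε ≤ sfatDim (sigmaBlock H q) ε :=
      (MarginReduces.of_subset_of_le (Set.image_mono fun _ hf => hf.1) le_rfl).sfatDim_le
    have hmin := min_sfatDim_sigmaBlock_add_one_le hL.nonempty hR.nonempty
    rcases min_choice (sfatDim (sigmaBlock {f ∈ H | θ + ε ≤ f ⟨p, x⟩} p) ε)
      (sfatDim (sigmaBlock {f ∈ H | f ⟨p, x⟩ ≤ θ} p) ε) with heq | heq <;> rw [heq] at hmin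
    · exact (add_le_add_left (ih hL) 1).trans (sum_add_le_sum_of_le_of_add_le hsub hmin)
    · exact (add_le_add_left (ih hR) 1).trans (sum_add_le_sum_of_le_of_add_le hsub hmin)

theorem sfatDim_le_sum_sigmaBlock (H : Set ((Σ p, X p) → ℝ)) :
    sfatDim H ε ≤ ∑ p, sfatDim (sigmaBlock H p) ε :=
  iSup₂_le fun _ h => SeqShatters.le_sum_sigmaBlock h

end DisjointUnion

section SauerShelah

variable {X J : Type*} {F : Set (X → ℝ)} {ε : ℝ} {d n : ℕ}

theorem fatShatters_card_of_shatters [DecidableEq J] {x : J → X} (hx : Function.Injective x)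
    {θ : J → ℝ} {𝒜 : Finset (Finset J)} {s : Finset J} (hs : 𝒜.Shatters s)
    (h𝒜 : ∀ u ∈ 𝒜, ∃ f ∈ F, ∀ j, (j ∈ u → θ j + ε ≤ f (x j)) ∧ (j ∉ u → f (x j) ≤ θ j)) :
    FatShatters F ε s.card := by
  rw [← Fintype.card_coe]
  refine FatShatters.of_fintype (hx.comp Subtype.val_injective) (fun j => θ j) fun b => ?_
  obtain ⟨u, hu, hsu⟩ := hs (t := ({j | b j = true} : Finset s).map (.subtype (· ∈ s)))
    (Finset.map_subtype_subset _)
  obtain ⟨f, hf, hfu⟩ := h𝒜 u hu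
  have hmem (j : s) : (j : J) ∈ u ↔ b j = true := by
    simpa using Finset.ext_iff.1 hsu j
  exact ⟨f, hf, fun j => ⟨fun hb => (hfu j).1 ((hmem j).2 hb),
    fun hb => (hfu j).2 fun hj => by simp [(hmem j).1 hj] at hb⟩⟩

theorem card_le_sum_choose_of_fatDim_le [Fintype J] (hd : fatDim F ε ≤ d) {x : J → X}
    (hx : Function.Injective x) {θ : J → ℝ} {𝒜 : Finset (Finset J)}
    (h𝒜 : ∀ u ∈ 𝒜, ∃ f ∈ F, ∀ j, (j ∈ u → θ j + ε ≤ f (x j)) ∧ (j ∉ u → f (x j) ≤ θ j)) :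
    𝒜.card ≤ ∑ i ∈ Finset.Iic d, (Fintype.card J).choose i := by
  classical
  have hvc : 𝒜.vcDim ≤ d := Finset.sup_le fun s hs => by
    have hsd := (fatShatters_card_of_shatters hx (Finset.mem_shatterer.1 hs) h𝒜).le_fatDim
    exact_mod_cast hsd.trans hd
  calc 𝒜.card ≤ 𝒜.shatterer.card := Finset.card_le_card_shatterer 𝒜
    _ ≤ ∑ i ∈ Finset.Iic 𝒜.vcDim, (Fintype.card J).choose i := Finset.card_shatterer_le_sum_vcDim
    _ ≤ ∑ i ∈ Finset.Iic d, (Fintype.card J).choose i :=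
      Finset.sum_le_sum_of_subset (Finset.Iic_subset_Iic.2 hvc)

theorem FatShatters.two_pow_le_of_biUnion {ι : Type*} {s : Finset ι} {H : ι → Set (X → ℝ)}
    (hd : ∀ c ∈ s, fatDim (H c) ε ≤ d) (h : FatShatters (⋃ c ∈ s, H c) ε n) :
    2 ^ n ≤ (∑ i ∈ Finset.Iic d, n.choose i) * s.card := by
  classical
  obtain ⟨x, θ, hx, h⟩ := h
  choose f hf hfu using fun u : Finset (Fin n) => h fun j => decide (j ∈ u)
  simp only [decide_eq_true_eq, decide_eq_false_iff_not] at hfu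
  choose c hc hfc using fun u => Set.mem_iUnion₂.1 (hf u)
  have hfiber := Finset.card_le_mul_card_image_of_maps_to (s := Finset.univ) (fun u _ => hc u)
    (∑ i ∈ Finset.Iic d, n.choose i) fun a ha => ?_
  · simpa using hfiber
  · refine (card_le_sum_choose_of_fatDim_le (hd a ha) hx (θ := θ) fun u hu => ?_).trans_eq (by simp)
    exact ⟨f u, (Finset.mem_filter.1 hu).2 ▸ hfc u, hfu u⟩

end SauerShelah

theorem pow_mul_sum_Iic_choose_le {x : ℝ} (hx : x ∈ Set.Icc (0 : ℝ) 1) (n d : ℕ) :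
    x ^ d * ∑ i ∈ Finset.Iic d, (n.choose i : ℝ) ≤ (1 + x) ^ n := by
  calc x ^ d * ∑ i ∈ Finset.Iic d, (n.choose i : ℝ)
      ≤ ∑ i ∈ Finset.Iic d, x ^ i * n.choose i := by
        rw [Finset.mul_sum]
        exact Finset.sum_le_sum fun i hi => mul_le_mul_of_nonneg_right
          (pow_le_pow_of_le_one hx.1 hx.2 (Finset.mem_Iic.1 hi)) (Nat.cast_nonneg _)
    _ ≤ ∑ i ∈ Finset.Iic d ∪ Finset.range (n + 1), x ^ i * n.choose i :=
        Finset.sum_le_sum_of_subset_of_nonneg Finset.subset_union_left fun i _ _ =>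
          mul_nonneg (pow_nonneg hx.1 i) (Nat.cast_nonneg _)
    _ = ∑ i ∈ Finset.range (n + 1), x ^ i * n.choose i :=
        (Finset.sum_subset Finset.subset_union_right fun i _ hi => by
          rw [Nat.choose_eq_zero_of_lt (by simpa using hi), Nat.cast_zero, mul_zero]).symm
    _ = (1 + x) ^ n := by simp only [add_comm 1 x, add_pow, one_pow, mul_one]

theorem le_of_two_pow_le_sum_Iic_choose_mul {n d : ℕ} {r : ℝ} (hr : 1 ≤ r)
    (h : 2 ^ n ≤ (∑ i ∈ Finset.Iic d, (n.choose i : ℝ)) * r) : n ≤ 4 * (d + Real.log r) := by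
  -- Any `x < 1` in `pow_mul_sum_Iic_choose_le` gives such a bound, as `(1 + x) ^ n` is then
  -- exponentially smaller than `2 ^ n`; `x = 1 / 4` gives the factor `4`.
  have hpow : (1 / 4 : ℝ) ^ d * 2 ^ n ≤ (1 + 1 / 4) ^ n * r := by
    calc (1 / 4 : ℝ) ^ d * 2 ^ n
        ≤ (1 / 4 : ℝ) ^ d * ((∑ i ∈ Finset.Iic d, (n.choose i : ℝ)) * r) := by gcongr
      _ = ((1 / 4 : ℝ) ^ d * ∑ i ∈ Finset.Iic d, (n.choose i : ℝ)) * r := (mul_assoc _ _ _).symm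
      _ ≤ (1 + 1 / 4) ^ n * r := by
        gcongr
        exact pow_mul_sum_Iic_choose_le (by norm_num) n d
  have hlog := Real.log_le_log (by positivity) hpow
  rw [Real.log_mul (by positivity) (by positivity), Real.log_mul (by positivity) (by positivity),
    Real.log_pow, Real.log_pow, Real.log_pow] at hlog
  have hlog_quarter : Real.log (1 / 4) = -(2 * Real.log 2) := by
    rw [one_div, Real.log_inv, show (4 : ℝ) = 2 ^ 2 by norm_num, Real.log_pow, Nat.cast_ofNat]
  have hlog_five : Real.log (1 + 1 / 4) ≤ 1 / 4 := by
    linarith [Real.log_le_sub_one_of_pos (show (0 : ℝ) < 1 + 1 / 4 by norm_num)]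
  have hn : 0.44 * n ≤ Real.log 2 * n - 1 / 4 * n := by
    nlinarith [Real.log_two_gt_d9, n.cast_nonneg (α := ℝ)]
  have hd : Real.log 2 * d ≤ 0.7 * d := by gcongr; linarith [Real.log_two_lt_d9]
  have hn_five : n * Real.log (1 + 1 / 4) ≤ n * (1 / 4) := by gcongr
  rw [hlog_quarter] at hlog
  linarith [Real.log_nonneg hr, d.cast_nonneg (α := ℝ)]

theorem fatrDim_biUnion_le {ι X : Type*} {ε : ℝ} (hε : 0 < ε) (s : Finset ι)
    (H : ι → Set (X → ℝ)) : fatrDim (⋃ c ∈ s, H c) ε ≤ ∑ c ∈ s, fatrDim (H c) ε := by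
  classical
  refine iSup₂_le fun d ⟨f, x, θ, _, _, hf, h⟩ => ?_
  choose c hc hfc using fun i => Set.mem_iUnion₂.1 (hf i)
  have hclass (a : ι) : FatThresholds (H a) ε (Fintype.card {i // c i = a}) :=
    FatThresholds.of_linearOrder hε (f := fun i => f i)
      (fun i => by simpa only [i.2] using hfc i) fun i j => h i j
  calc (d : ℕ∞) = ∑ a ∈ s, (Fintype.card {i // c i = a} : ℕ∞) := by
        have hcard := Finset.card_eq_sum_card_fiberwise (s := Finset.univ) fun i _ => hc i
        simp only [Finset.card_univ, Fintype.card_fin] at hcard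
        simp only [Fintype.card_subtype]
        exact_mod_cast hcard
    _ ≤ ∑ a ∈ s, fatrDim (H a) ε := Finset.sum_le_sum fun a _ => (hclass a).le_fatrDim

section Shifts

variable {X : Type*} {F : Set (X → ℝ)} {ε : ℝ}

/-- The class of the translates `f - s` of the functions `f ∈ F` by the constants `s ∈ I`. -/
def shifts (F : Set (X → ℝ)) (I : Set ℝ) : Set (X → ℝ) :=
  Set.image2 (fun f s x => f x - s) F I

theorem marginReduces_shifts_Icc (F : Set (X → ℝ)) (ε δ v : ℝ) :
    MarginReduces (shifts F (Set.Icc v (v + δ))) (ε + δ) F ε := by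
  refine ⟨v + δ, ?_⟩
  rintro _ ⟨f, hf, s, ⟨hvs, hsv⟩, rfl⟩
  exact ⟨f, hf, fun x θ => ⟨fun _ => by linarith, fun _ => by linarith⟩⟩

theorem marginReduces_shifts_Icc_two_mul (F : Set (X → ℝ)) (ε v : ℝ) :
    MarginReduces (shifts F (Set.Icc v (v + ε))) (2 * ε) F ε :=
  (two_mul ε).symm ▸ marginReduces_shifts_Icc F ε ε v

theorem Icc_subset_biUnion_Icc_add (hε : 0 < ε) {a b : ℝ} {N : ℕ} (hN : b < a + N * ε) :
    Set.Icc a b ⊆ ⋃ j ∈ Finset.range N, Set.Icc (a + j * ε) (a + j * ε + ε) := by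
  intro s ⟨has, hsb⟩
  have hdiv : 0 ≤ (s - a) / ε := div_nonneg (sub_nonneg.2 has) hε.le
  have hfloor := Nat.floor_le hdiv
  have hlt := Nat.lt_floor_add_one ((s - a) / ε)
  rw [le_div_iff₀ hε] at hfloor
  rw [div_lt_iff₀ hε] at hlt
  refine Set.mem_iUnion₂.2 ⟨⌊(s - a) / ε⌋₊, Finset.mem_range.2 ?_, by linarith, by linarith⟩
  rw [Nat.floor_lt hdiv, div_lt_iff₀ hε]
  linarith

theorem shifts_Icc_subset_biUnion (hε : 0 < ε) (F : Set (X → ℝ)) {a b : ℝ} {N : ℕ}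
    (hN : b < a + N * ε) : shifts F (Set.Icc a b) ⊆
      ⋃ j ∈ Finset.range N, shifts F (Set.Icc (a + j * ε) (a + j * ε + ε)) :=
  (Set.image2_subset_left (Icc_subset_biUnion_Icc_add hε hN)).trans_eq
    (Set.image2_iUnion₂_right _ _ _)

theorem sfatDim_shifts_Icc_le (hε : 0 < ε) (F : Set (X → ℝ)) {a b : ℝ} {N : ℕ}
    (hN : b < a + N * ε) : sfatDim (shifts F (Set.Icc a b)) (2 * ε) ≤ N * (sfatDim F ε + 1) :=
  calc sfatDim (shifts F (Set.Icc a b)) (2 * ε)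
    _ ≤ sfatDim (⋃ j ∈ Finset.range N, shifts F (Set.Icc (a + j * ε) (a + j * ε + ε))) (2 * ε) :=
        (MarginReduces.of_subset_of_le (shifts_Icc_subset_biUnion hε F hN) le_rfl).sfatDim_le
    _ ≤ ∑ j ∈ Finset.range N,
          (sfatDim (shifts F (Set.Icc (a + j * ε) (a + j * ε + ε))) (2 * ε) + 1) :=
        sfatDim_biUnion_le _ _
    _ ≤ ∑ _ ∈ Finset.range N, (sfatDim F ε + 1) := by
        gcongr
        exact (marginReduces_shifts_Icc_two_mul F ε _).sfatDim_le
    _ = N * (sfatDim F ε + 1) := by rw [Finset.sum_const, Finset.card_range, nsmul_eq_mul]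

theorem fatDim_shifts_Icc_le (hε : 0 < ε) {a b : ℝ} {d N : ℕ} (hN : b < a + N * ε)
    (hN_pos : 1 ≤ N) (hd : fatDim F ε ≤ d) :
    fatDim (shifts F (Set.Icc a b)) (2 * ε) ≤ ⌊4 * (d + Real.log N)⌋₊ := by
  refine (MarginReduces.of_subset_of_le (shifts_Icc_subset_biUnion hε F hN)
    le_rfl).fatDim_le.trans (iSup₂_le fun n hn => ?_)
  have hpow := hn.two_pow_le_of_biUnion fun j _ =>
    (marginReduces_shifts_Icc_two_mul F ε _).fatDim_le.trans hd
  rw [Finset.card_range] at hpow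
  exact_mod_cast Nat.le_floor (le_of_two_pow_le_sum_Iic_choose_mul (by exact_mod_cast hN_pos)
    (by exact_mod_cast hpow))

/-- The column of the first row bounds the shifts of all the later rows from below, and the diagonal
bounds them from above, so that these shifts fit into `⌊1 / ε⌋ - 1` windows of length `ε`. -/
theorem FatThresholds.exists_biUnion_shifts_Icc (hF : ∀ f ∈ F, ∀ x, f x ∈ Set.Icc (0 : ℝ) 1)
    {I : Set ℝ} {n : ℕ} (hε : 0 < ε) (hε1 : ε ≤ 1) (h : FatThresholds (shifts F I) (2 * ε) n) :
    ∃ v : ℕ → ℝ, FatThresholds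
      (⋃ j ∈ Finset.range ⌊1 / ε⌋₊, shifts F (Set.Icc (v j) (v j + ε))) (2 * ε) n := by
  obtain ⟨f, x, θ, hf_inj, hx_inj, hf, hpat⟩ := h
  rcases n with _ | n
  · exact ⟨0, f, x, θ, hf_inj, hx_inj, fun i => i.elim0, hpat⟩
  choose g hg s _ hgs using hf
  obtain ⟨N, hN⟩ : ∃ N, ⌊1 / ε⌋₊ = N + 1 :=
    Nat.exists_eq_add_one.2 (Nat.floor_pos.2 ((one_le_div hε).2 hε1))
  have hN_lt : -θ + (1 - 2 * ε) < -θ + N * ε := by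
    have hlt := Nat.lt_floor_add_one (1 / ε)
    rw [hN, div_lt_iff₀ hε] at hlt
    push_cast at hlt
    linarith
  have hs (i : Fin n) : s i.succ ∈ Set.Icc (-θ) (-θ + (1 - 2 * ε)) := by
    have hfirst := (hpat i.succ 0).2 i.succ_pos
    have hdiag := (hpat i.succ i.succ).1 le_rfl
    rw [← hgs] at hfirst hdiag
    constructor
    · linarith [(hF _ (hg i.succ) (x 0)).1]
    · linarith [(hF _ (hg i.succ) (x i.succ)).2]
  let v : ℕ → ℝ := fun | 0 => s 0 | j + 1 => -θ + j * ε
  refine ⟨v, f, x, θ, hf_inj, hx_inj, fun i => ?_, hpat⟩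
  rw [hN, ← hgs]
  cases i using Fin.cases with
  | zero => exact Set.mem_iUnion₂.2 ⟨0, by simp, _, hg 0, s 0, ⟨le_rfl, by simp [v, hε.le]⟩, rfl⟩
  | succ i =>
    obtain ⟨j, hj, hsj⟩ := Set.mem_iUnion₂.1 (Icc_subset_biUnion_Icc_add hε hN_lt (hs i))
    exact Set.mem_iUnion₂.2 ⟨j + 1, by simpa using hj, _, hg i.succ, _, hsj, rfl⟩

theorem fatrDim_shifts_le (hF : ∀ f ∈ F, ∀ x, f x ∈ Set.Icc (0 : ℝ) 1) (hε : 0 < ε) (hε1 : ε ≤ 1)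
    (I : Set ℝ) : fatrDim (shifts F I) (2 * ε) ≤ ⌊1 / ε⌋₊ * fatrDim F ε := by
  refine iSup₂_le fun n hn => ?_
  obtain ⟨v, hv⟩ := hn.exists_biUnion_shifts_Icc hF hε hε1
  calc (n : ℕ∞)
    _ ≤ fatrDim (⋃ j ∈ Finset.range ⌊1 / ε⌋₊, shifts F (Set.Icc (v j) (v j + ε))) (2 * ε) :=
        hv.le_fatrDim
    _ ≤ ∑ j ∈ Finset.range ⌊1 / ε⌋₊, fatrDim (shifts F (Set.Icc (v j) (v j + ε))) (2 * ε) :=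
        fatrDim_biUnion_le (by positivity) _ _
    _ ≤ ∑ _ ∈ Finset.range ⌊1 / ε⌋₊, fatrDim F ε := by
        gcongr
        exact (marginReduces_shifts_Icc_two_mul F ε _).fatrDim_le hε
    _ = ⌊1 / ε⌋₊ * fatrDim F ε := by rw [Finset.sum_const, Finset.card_range, nsmul_eq_mul]

end Shifts

theorem fatDim_le_sfatDim {X : Type*} (F : Set (X → ℝ)) (ε : ℝ) : fatDim F ε ≤ sfatDim F ε := by
  refine iSup₂_le fun d ⟨x, θ, _, h⟩ => ?_
  choose f hf hfb using h
  let T : LabelledTree X d := ⟨fun i _ => x i, fun i _ => θ i, f⟩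
  have hT : T.IsShattered F ε := ⟨hf, hfb⟩
  exact hT.le_sfatDim

theorem sfatDim_eq_zero_of_forall_mem_Icc {X : Type*} {F : Set (X → ℝ)} {a b ε : ℝ}
    (hε : b < a + ε) (hF : ∀ f ∈ F, ∀ x, f x ∈ Set.Icc a b) : sfatDim F ε = 0 := by
  refine nonpos_iff_eq_zero.1 (iSup₂_le fun d (hd : SeqShatters F ε d) => ?_)
  cases d with
  | zero => exact le_rfl
  | succ d =>
    obtain ⟨x, θ, hL, hR⟩ := seqShatters_succ_iff.1 hd
    obtain ⟨f, hf, hfx⟩ := hL.nonempty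
    obtain ⟨g, hg, hgx⟩ := hR.nonempty
    linarith [(hF f hf x).2, (hF g hg x).1]

theorem exists_nat_one_lt_mul_and_le_two_div {ε : ℝ} (hε : 0 < ε) (hε1 : ε ≤ 1) :
    ∃ N : ℕ, 1 < N * ε ∧ (N : ℝ) ≤ 2 / ε := by
  refine ⟨⌊1 / ε⌋₊ + 1, ?_, ?_⟩
  · rw [← div_lt_iff₀ hε]
    exact_mod_cast Nat.lt_floor_add_one (1 / ε)
  · have hfloor : (⌊1 / ε⌋₊ : ℝ) ≤ 1 / ε := Nat.floor_le (by positivity)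
    have hone : 1 ≤ 1 / ε := (one_le_div hε).2 hε1
    push_cast
    linarith [add_div 1 1 ε]

theorem add_log_two_div_le_mul_log_mul_log_sq {D ε : ℝ} (hD : 2 ≤ D) (hε : 0 < ε)
    (hε8 : ε ≤ 1 / 8) : D + Real.log (2 / ε) ≤ D * Real.log D * Real.log (1 / ε) ^ 2 := by
  set L := Real.log (1 / ε) with hL_def
  have hlog_two := Real.log_two_gt_d9
  have hlog_eight : Real.log 8 = 3 * Real.log 2 := by
    rw [show (8 : ℝ) = 2 ^ 3 by norm_num, Real.log_pow, Nat.cast_ofNat]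
  have hL : 2 ≤ L := by
    have hmono : Real.log 8 ≤ L := Real.log_le_log (by norm_num) (by rw [le_div_iff₀ hε]; linarith)
    linarith
  have hD_le : D * 2 ^ 2 ≤ D * L ^ 2 := by gcongr
  have hL_le : 2 * (2 * L) ≤ D * L ^ 2 := by rw [pow_two]; gcongr
  have hDL : 0.69 * (D * L ^ 2) ≤ Real.log 2 * (D * L ^ 2) := by gcongr; linarith
  have hsplit : Real.log (2 / ε) = Real.log 2 + L := by
    rw [hL_def, ← Real.log_mul (by norm_num) (by positivity), mul_one_div]
  have hD_log : D * Real.log 2 ≤ D * Real.log D := by gcongr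
  calc D + Real.log (2 / ε) = D + Real.log 2 + L := by rw [hsplit, add_assoc]
    _ ≤ D * Real.log 2 * L ^ 2 := by linarith [Real.log_two_lt_d9]
    _ ≤ D * Real.log D * L ^ 2 := by gcongr

theorem toENNReal_le_ofReal_mul {x y : ℕ∞} {n : ℕ} {r : ℝ} (hxy : x ≤ n * y) (hnr : (n : ℝ) ≤ r) :
    (x : ENNReal) ≤ ENNReal.ofReal r * (y : ENNReal) :=
  calc (x : ENNReal) ≤ ((n * y : ℕ∞) : ENNReal) := ENat.toENNReal_mono hxy
    _ = ENNReal.ofReal n * (y : ENNReal) := by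
        rw [ENat.toENNReal_mul, ENat.toENNReal_coe, ENNReal.ofReal_natCast]
    _ ≤ ENNReal.ofReal r * (y : ENNReal) := by gcongr

namespace Game

variable {k : ℕ} {G : Game.{v} k} {ε : ℝ}

theorem utilityClass_mem_Icc {p : Fin k} (hu : ∀ a, G.utility p a ∈ Set.Icc (0 : ℝ) 1) :
    ∀ f ∈ G.utilityClass p, ∀ x, f x ∈ Set.Icc (0 : ℝ) 1 := by
  rintro _ ⟨b, rfl⟩ x
  exact hu _

theorem cceClass_mem_Icc (hu : ∀ p a, G.utility p a ∈ Set.Icc (0 : ℝ) 1) :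
    ∀ f ∈ G.cceClass, ∀ y, f y ∈ Set.Icc (-1 : ℝ) 1 := by
  rintro _ ⟨a, rfl⟩ ⟨p, x⟩
  obtain ⟨hdev_nonneg, hdev_le⟩ := hu p (G.combine p x (G.others p a))
  obtain ⟨hplay_nonneg, hplay_le⟩ := hu p a
  rw [cceMatrix]
  constructor <;> linarith

theorem sigmaBlock_cceClass_subset {p : Fin k} (hu : ∀ a, G.utility p a ∈ Set.Icc (0 : ℝ) 1) :
    sigmaBlock G.cceClass p ⊆ shifts (G.utilityClass p) (Set.Icc 0 1) := by
  rintro _ ⟨_, ⟨a, rfl⟩, rfl⟩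
  exact ⟨_, ⟨G.others p a, rfl⟩, _, hu a, rfl⟩

theorem marginReduces_sigmaBlock_cceClass {p : Fin k} (hu : ∀ a, G.utility p a ∈ Set.Icc (0 : ℝ) 1)
    (ε : ℝ) : MarginReduces (sigmaBlock G.cceClass p) ε
      (shifts (G.utilityClass p) (Set.Icc 0 1)) ε :=
  .of_subset_of_le (sigmaBlock_cceClass_subset hu) le_rfl

theorem fatDim_cceClass_le (hu : ∀ p a, G.utility p a ∈ Set.Icc (0 : ℝ) 1) (hε : 0 < ε) {d N : ℕ}
    (hN : 1 < N * ε) (hd : G.fat ε ≤ d) :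
    fatDim G.cceClass (2 * ε) ≤ k * (⌊4 * (d + Real.log N)⌋₊ : ℕ∞) := by
  have hN_pos : 1 ≤ N := Nat.one_le_iff_ne_zero.2 fun hN0 => by norm_num [hN0] at hN
  have hblock (p : Fin k) : fatDim (sigmaBlock G.cceClass p) (2 * ε) ≤ ⌊4 * (d + Real.log N)⌋₊ :=
    (marginReduces_sigmaBlock_cceClass (hu p) _).fatDim_le.trans
      (fatDim_shifts_Icc_le hε (by simpa using hN) hN_pos ((le_iSup _ p).trans hd))
  calc fatDim G.cceClass (2 * ε) ≤ ∑ p, fatDim (sigmaBlock G.cceClass p) (2 * ε) :=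
        fatDim_le_sum_sigmaBlock _
    _ ≤ ∑ _ : Fin k, (⌊4 * (d + Real.log N)⌋₊ : ℕ∞) := Finset.sum_le_sum fun p _ => hblock p
    _ = k * (⌊4 * (d + Real.log N)⌋₊ : ℕ∞) := by simp

theorem sfatDim_cceClass_le (hu : ∀ p a, G.utility p a ∈ Set.Icc (0 : ℝ) 1) (hε : 0 < ε) {N : ℕ}
    (hN : 1 < N * ε) : sfatDim G.cceClass (2 * ε) ≤ k * (N * (G.sfat ε + 1)) := by
  have hblock (p : Fin k) :
      sfatDim (sigmaBlock G.cceClass p) (2 * ε) ≤ N * (G.sfat ε + 1) :=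
    calc sfatDim (sigmaBlock G.cceClass p) (2 * ε)
      _ ≤ sfatDim (shifts (G.utilityClass p) (Set.Icc 0 1)) (2 * ε) :=
          (marginReduces_sigmaBlock_cceClass (hu p) _).sfatDim_le
      _ ≤ N * (sfatDim (G.utilityClass p) ε + 1) :=
          sfatDim_shifts_Icc_le hε _ (by simpa using hN)
      _ ≤ N * (G.sfat ε + 1) := by
          gcongr
          exact le_iSup (fun p => sfatDim (G.utilityClass p) ε) p
  calc sfatDim G.cceClass (2 * ε) ≤ ∑ p, sfatDim (sigmaBlock G.cceClass p) (2 * ε) :=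
        sfatDim_le_sum_sigmaBlock _
    _ ≤ ∑ _ : Fin k, N * (G.sfat ε + 1) := Finset.sum_le_sum fun p _ => hblock p
    _ = k * (N * (G.sfat ε + 1)) := by simp

theorem fatrDim_cceClass_le (hu : ∀ p a, G.utility p a ∈ Set.Icc (0 : ℝ) 1) (hε : 0 < ε)
    (hε1 : ε ≤ 1) : fatrDim G.cceClass (2 * ε) ≤ k * (⌊1 / ε⌋₊ * G.fatr ε) := by
  have hblock (p : Fin k) :
      fatrDim (sigmaBlock G.cceClass p) (2 * ε) ≤ ⌊1 / ε⌋₊ * G.fatr ε :=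
    calc fatrDim (sigmaBlock G.cceClass p) (2 * ε)
      _ ≤ fatrDim (shifts (G.utilityClass p) (Set.Icc 0 1)) (2 * ε) :=
          (marginReduces_sigmaBlock_cceClass (hu p) _).fatrDim_le (by positivity)
      _ ≤ ⌊1 / ε⌋₊ * fatrDim (G.utilityClass p) ε :=
          fatrDim_shifts_le (utilityClass_mem_Icc (hu p)) hε hε1 _
      _ ≤ ⌊1 / ε⌋₊ * G.fatr ε := by
          gcongr
          exact le_iSup (fun p => fatrDim (G.utilityClass p) ε) p
  calc fatrDim G.cceClass (2 * ε) ≤ ∑ p, fatrDim (sigmaBlock G.cceClass p) (2 * ε) :=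
        fatrDim_le_sum_sigmaBlock (by positivity) _
    _ ≤ ∑ _ : Fin k, ⌊1 / ε⌋₊ * G.fatr ε := Finset.sum_le_sum fun p _ => hblock p
    _ = k * (⌊1 / ε⌋₊ * G.fatr ε) := by simp

theorem toENNReal_fatDim_cceClass_le (hu : ∀ p a, G.utility p a ∈ Set.Icc (0 : ℝ) 1) (hε : 0 < ε)
    {d : ℕ} (hd : G.fat ε ≤ d) : (fatDim G.cceClass (16 * ε) : ENNReal) ≤
      ENNReal.ofReal (4 * (k * max (d : ℝ) 2 * Real.log (max (d : ℝ) 2) *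
        Real.log (1 / ε) ^ 2)) := by
  rcases lt_or_ge (1 / 8) ε with hε8 | hε8
  · have hzero := sfatDim_eq_zero_of_forall_mem_Icc (ε := 16 * ε) (by linarith)
      (cceClass_mem_Icc hu)
    simp [nonpos_iff_eq_zero.1 ((fatDim_le_sfatDim _ _).trans_eq hzero)]
  obtain ⟨N, hN, hN_le⟩ := exists_nat_one_lt_mul_and_le_two_div hε (by linarith)
  have hN_pos : (0 : ℝ) < N := pos_of_mul_pos_left (one_pos.trans hN) hε.le
  have hle : fatDim G.cceClass (16 * ε) ≤ (k * ⌊4 * (d + Real.log N)⌋₊ : ℕ) * 1 := by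
    rw [mul_one, Nat.cast_mul]
    exact (MarginReduces.of_subset_of_le subset_rfl (by linarith)).fatDim_le.trans
      (fatDim_cceClass_le hu hε hN hd)
  have hreal : ((k * ⌊4 * (d + Real.log N)⌋₊ : ℕ) : ℝ) ≤
      4 * (k * max (d : ℝ) 2 * Real.log (max (d : ℝ) 2) * Real.log (1 / ε) ^ 2) :=
    calc ((k * ⌊4 * (d + Real.log N)⌋₊ : ℕ) : ℝ) ≤ k * (4 * (d + Real.log N)) := by
          have := Real.log_natCast_nonneg N
          push_cast
          gcongr
          exact Nat.floor_le (by positivity)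
      _ ≤ k * (4 * (max (d : ℝ) 2 + Real.log (2 / ε))) := by
          gcongr
          exact le_max_left _ _
      _ ≤ k * (4 * (max (d : ℝ) 2 * Real.log (max (d : ℝ) 2) * Real.log (1 / ε) ^ 2)) := by
          gcongr
          exact add_log_two_div_le_mul_log_mul_log_sq (le_max_right _ _) hε hε8
      _ = _ := by ring
  simpa using toENNReal_le_ofReal_mul hle hreal

theorem toENNReal_sfatDim_cceClass_le (hu : ∀ p a, G.utility p a ∈ Set.Icc (0 : ℝ) 1)
    (hε : 0 < ε) : (sfatDim G.cceClass (2 * ε) : ENNReal) ≤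
      ENNReal.ofReal (4 * (k / ε)) * ((max (G.sfat ε) 1 : ℕ∞) : ENNReal) := by
  rcases lt_or_ge 1 ε with hε1 | hε1
  · simp [sfatDim_eq_zero_of_forall_mem_Icc (ε := 2 * ε) (by linarith) (cceClass_mem_Icc hu)]
  obtain ⟨N, hN, hN_le⟩ := exists_nat_one_lt_mul_and_le_two_div hε hε1
  refine toENNReal_le_ofReal_mul (n := k * N * 2) ?_ ?_
  · calc sfatDim G.cceClass (2 * ε) ≤ k * (N * (G.sfat ε + 1)) := sfatDim_cceClass_le hu hε hN
      _ ≤ k * (N * (max (G.sfat ε) 1 + max (G.sfat ε) 1)) := by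
          gcongr
          exacts [le_max_left _ _, le_max_right _ _]
      _ = (k * N * 2 : ℕ) * max (G.sfat ε) 1 := by
          push_cast
          ring
  · calc ((k * N * 2 : ℕ) : ℝ) ≤ k * (2 / ε) * 2 := by
          push_cast
          gcongr
      _ = 4 * (k / ε) := by ring

theorem toENNReal_fatrDim_cceClass_le (hu : ∀ p a, G.utility p a ∈ Set.Icc (0 : ℝ) 1)
    (hε : 0 < ε) (hε1 : ε ≤ 1) : (fatrDim G.cceClass (2 * ε) : ENNReal) ≤
      ENNReal.ofReal (k / ε) * (G.fatr ε : ENNReal) := by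
  refine toENNReal_le_ofReal_mul (n := k * ⌊1 / ε⌋₊) ?_ ?_
  · rw [Nat.cast_mul, mul_assoc]
    exact fatrDim_cceClass_le hu hε hε1
  · rw [Nat.cast_mul, div_eq_mul_one_div (k : ℝ)]
    gcongr
    exact Nat.floor_le (by positivity)

end Game

theorem mainTheorem7 :
    ∃ C : ℝ, 0 < C ∧ ∀ (k : ℕ) (G : Game.{v} k),
      (∀ (p : Fin k) (a : G.Profile), G.utility p a ∈ Set.Icc (0 : ℝ) 1) →
      ∀ ε : ℝ, 0 < ε →
        (∀ d : ℕ, G.fat ε = d →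
          (fatDim G.cceClass (16 * ε) : ENNReal) ≤
            ENNReal.ofReal (C * (k * max (d : ℝ) 2 * Real.log (max (d : ℝ) 2) *
              Real.log (1 / ε) ^ 2))) ∧
        ((sfatDim G.cceClass (2 * ε) : ENNReal) ≤
          ENNReal.ofReal (C * (k / ε)) * ((max (G.sfat ε) 1 : ℕ∞) : ENNReal)) ∧
        (ε ≤ 1 →
          (fatrDim G.cceClass (2 * ε) : ENNReal) ≤
            ENNReal.ofReal (k / ε) * (G.fatr ε : ENNReal)) :=
  ⟨4, by norm_num, fun _ _ hu _ hε =>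
    ⟨fun _ hd => Game.toENNReal_fatDim_cceClass_le hu hε hd.le,
      Game.toENNReal_sfatDim_cceClass_le hu hε, Game.toENNReal_fatrDim_cceClass_le hu hε⟩⟩
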